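/- Let $K,M,\lambda>0$, put $\delta=\lambda M$, and write $K=lM+\Delta$ with an integer $l\ge 0$ and $0\le\Delta<M$. Let $X(0),X(1),\dots$ be i.i.d. exponential random variables with density $f(x)=\lambda e^{-\lambda x}$, $x\ge 0$ (so the mean is $1/\lambda$), and let $\{B(i)\}_{i\ge0}$ be the storage process on $[0,K]$ given by $$B(i+1)=\min\big([B(i)-M]^+ + X(i),\,K\big),\qquad [x]^+=\max(x,0),$$ where $B(0)\in[0,K]$ is independent of the $X(i)$. This Markov chain has exactly one stationary distribution $\pi$, and for every initial distribution on $[0,K]$ the law of $B(i)$ converges to $\pi$ in total variation as $i\to\infty$. The distribution $\pi$ consists of an atom of mass $\pi(K)=\pi(\{K\})$ at $K$ and an absolutely continuous part with a density $g\ge0$ on $[0,K)$. Put $l'=l-1$ if $\Delta=0$ and $l'=l$ if $\Delta\ne0$. For every $n=0,\dots,l'$ and every $x$ with $[K-(n+1)M]^+\le x<K-nM$, $$g(x)=\pi(K)\,\lambda e^{-\lambda(x-K)}\Bigg[1+\sum_{q=1}^{n}\frac{e^{-\delta q}}{(q-1)!}\big(\delta q+\lambda(x-K)\big)^{q-1}\Big(\frac{\lambda(x-K)}{q}+\delta-1\Big)\Bigg],$$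 and $$\pi(K)=\Bigg\{\sum_{n=0}^{l-1}e^{n\delta}\Big(e^{\delta}-1+\sum_{q=1}^{n}\frac{(\delta e^{-\delta})^q}{q!}\big(e^{\delta}(q-(n+1))^q-(q-n)^q\big)\Big)+e^{l\delta}\Big(e^{\lambda\Delta}-1+\sum_{q=1}^{l}\frac{(\delta e^{-\delta})^q}{q!}\Big(e^{\lambda\Delta}\Big(q-\frac KM\Big)^q-(q-l)^q\Big)\Big)+1\Bigg\}^{-1}.$$ Here $0^0=1$ and empty sums are $0$. -/

import Mathlib

open Set Filter Topology MeasureTheory ProbabilityTheory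

universe u

/-- One step of the energy buffer of capacity `K` with desired transmit power `M`: from level `b`,
after transmission `min b M` is used up and `e` units of energy are harvested. -/
noncomputable def bufferStep (K M b e : ℝ) : ℝ := min (max (b - M) 0 + e) K

/-- `B` is a storage process with capacity `K` and desired power `M` on the probability space
`(Ω, P)`: the harvested energies `X 0, X 1, …` are i.i.d. with law `ν`, the initial level `B 0`
takes values in the state space `[0, K]` and is independent of the harvested energies, and
`B (i + 1) = min ([B i - M]⁺ + X i, K)`. -/
structure IsStorageProcess {Ω : Type u} [MeasurableSpace Ω] (P : Measure Ω) (K M : ℝ)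
    (ν : Measure ℝ) (X B : ℕ → Ω → ℝ) : Prop where
  measurable_harvest : ∀ i, Measurable (X i)
  law_harvest : ∀ i, P.map (X i) = ν
  indep_harvest : iIndepFun X P
  measurable_init : Measurable (B 0)
  init_mem : ∀ᵐ ω ∂P, B 0 ω ∈ Icc 0 K
  indep_init : IndepFun (B 0) (fun ω i => X i ω) P
  step : ∀ i ω, B (i + 1) ω = bufferStep K M (B i ω) (X i ω)

/-- `π` is a stationary distribution of the storage chain on the state space `[0, K]`: a chain
whose current level has law `π` also has law `π` one step later. -/
structure IsStationaryDistribution (K M : ℝ) (ν π : Measure ℝ) : Prop where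
  prob : IsProbabilityMeasure π
  support : π (Icc 0 K)ᶜ = 0
  invariant : (π.prod ν).map (fun p => bufferStep K M p.1 p.2) = π

/-- The total variation distance `sup_A |μ(A) - ν(A)|`, over the measurable sets `A`, of two
probability measures. -/
noncomputable def tvDistance (μ ν : Measure ℝ) : ℝ :=
  ⨆ A : {A : Set ℝ // MeasurableSet A}, |μ.real A - ν.real A|

/-- The law of the storage level one step after it had law `μ`. -/
noncomputable def bufferLaw (K M : ℝ) (ν μ : Measure ℝ) : Measure ℝ :=
  (μ.prod ν).map (fun p => bufferStep K M p.1 p.2)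

lemma measurable_bufferStep (K M : ℝ) :
    Measurable (fun p : ℝ × ℝ => bufferStep K M p.1 p.2) := by
  unfold bufferStep; fun_prop

lemma bufferStep_of_le {K M b e : ℝ} (h : K ≤ e) : bufferStep K M b e = K :=
  min_eq_right (h.trans (le_add_of_nonneg_left (le_max_right _ _)))

instance isProbabilityMeasure_bufferLaw (K M : ℝ) (ν μ : Measure ℝ) [IsProbabilityMeasure ν]
    [IsProbabilityMeasure μ] : IsProbabilityMeasure (bufferLaw K M ν μ) :=
  Measure.isProbabilityMeasure_map (measurable_bufferStep K M).aemeasurable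

lemma bufferLaw_apply (K M : ℝ) (ν μ : Measure ℝ) [SFinite ν] {A : Set ℝ}
    (hA : MeasurableSet A) :
    bufferLaw K M ν μ A = ∫⁻ b, ν {e | bufferStep K M b e ∈ A} ∂μ := by
  rw [bufferLaw, Measure.map_apply (measurable_bufferStep K M) hA,
    Measure.prod_apply (measurable_bufferStep K M hA)]
  rfl

lemma measurable_bufferStep_left (K M e : ℝ) : Measurable (fun b => bufferStep K M b e) := by
  unfold bufferStep; fun_prop

lemma measurable_bufferStep_right (K M b : ℝ) : Measurable (fun e => bufferStep K M b e) := by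
  unfold bufferStep; fun_prop

lemma bufferLaw_real_apply (K M : ℝ) (ν μ : Measure ℝ) [IsProbabilityMeasure ν]
    [IsProbabilityMeasure μ] {A : Set ℝ} (hA : MeasurableSet A) :
    Integrable (fun e => μ.real {b | bufferStep K M b e ∈ A}) ν ∧
    (bufferLaw K M ν μ).real A = ∫ e, μ.real {b | bufferStep K M b e ∈ A} ∂ν := by
  have hm : Measurable (fun e => μ {b | bufferStep K M b e ∈ A}) :=
    measurable_measure_prodMk_right (measurable_bufferStep K M hA)
  constructor
  · refine Integrable.of_bound hm.ennreal_toReal.aestronglyMeasurable 1 (ae_of_all _ fun e => ?_)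
    rw [Real.norm_of_nonneg measureReal_nonneg]
    exact measureReal_le_one
  · rw [Measure.real, bufferLaw, Measure.map_apply (measurable_bufferStep K M) hA,
      Measure.prod_apply_symm (measurable_bufferStep K M hA)]
    exact (integral_toReal hm.aemeasurable (ae_of_all _ fun e => measure_lt_top _ _)).symm

section TotalVariation

variable (μ ν : Measure ℝ) [IsProbabilityMeasure μ] [IsProbabilityMeasure ν]

lemma bddAbove_tvDistance :
    BddAbove (range fun A : {A : Set ℝ // MeasurableSet A} => |μ.real A - ν.real A|) := by
  refine ⟨1, ?_⟩
  rintro _ ⟨A, rfl⟩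
  have h1 : μ.real (A : Set ℝ) ≤ 1 := measureReal_le_one
  have h2 : ν.real (A : Set ℝ) ≤ 1 := measureReal_le_one
  have h3 : 0 ≤ μ.real (A : Set ℝ) := measureReal_nonneg
  have h4 : 0 ≤ ν.real (A : Set ℝ) := measureReal_nonneg
  rw [abs_le]
  constructor <;> linarith

lemma abs_sub_le_tvDistance {A : Set ℝ} (hA : MeasurableSet A) :
    |μ.real A - ν.real A| ≤ tvDistance μ ν :=
  le_ciSup (bddAbove_tvDistance μ ν) (⟨A, hA⟩ : {A : Set ℝ // MeasurableSet A})

lemma tvDistance_nonneg : 0 ≤ tvDistance μ ν :=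
  (abs_nonneg _).trans (abs_sub_le_tvDistance μ ν MeasurableSet.univ)

variable {μ ν} in
lemma eq_of_tvDistance_le_zero (h : tvDistance μ ν ≤ 0) : μ = ν := by
  ext A hA
  have h1 := (abs_sub_le_tvDistance μ ν hA).trans h
  have h2 := sub_eq_zero.1 (abs_nonpos_iff.1 h1)
  exact (measureReal_eq_measureReal_iff).1 h2

end TotalVariation

lemma tvDistance_bufferLaw_le (K M : ℝ) (ν μ π : Measure ℝ) [IsProbabilityMeasure ν]
    [IsProbabilityMeasure μ] [IsProbabilityMeasure π] :
    tvDistance (bufferLaw K M ν μ) (bufferLaw K M ν π) ≤ ν.real (Iio K) * tvDistance μ π := by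
  have : Nonempty {A : Set ℝ // MeasurableSet A} := ⟨⟨univ, MeasurableSet.univ⟩⟩
  refine ciSup_le ?_
  rintro ⟨A, hA⟩
  obtain ⟨i1, e1⟩ := bufferLaw_real_apply K M ν μ hA
  obtain ⟨i2, e2⟩ := bufferLaw_real_apply K M ν π hA
  simp only
  rw [e1, e2, ← integral_sub i1 i2, ← Real.norm_eq_abs]
  calc _ ≤ ∫ e, (Iio K).indicator (fun _ => tvDistance μ π) e ∂ν := by
        refine norm_integral_le_of_norm_le
          ((integrable_const _).indicator measurableSet_Iio) (ae_of_all _ fun e => ?_)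
        by_cases he : e < K
        · rw [indicator_of_mem (show e ∈ Iio K from he)]
          exact abs_sub_le_tvDistance μ π (measurable_bufferStep_left K M e hA)
        · rw [indicator_of_notMem (show e ∉ Iio K from he)]
          simp only [bufferStep_of_le (not_lt.1 he)]
          by_cases hk : K ∈ A <;> simp [hk]
    _ = _ := by rw [integral_indicator measurableSet_Iio]; simp

lemma IsStationaryDistribution.eq {K M : ℝ} {ν π π' : Measure ℝ} [IsProbabilityMeasure ν]
    (hν : ν.real (Iio K) < 1) (h : IsStationaryDistribution K M ν π)
    (h' : IsStationaryDistribution K M ν π') : π' = π := by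
  have := h.prob
  have := h'.prob
  have h1 := tvDistance_bufferLaw_le K M ν π' π
  rw [show bufferLaw K M ν π' = π' from h'.invariant,
    show bufferLaw K M ν π = π from h.invariant] at h1
  refine eq_of_tvDistance_le_zero ?_
  nlinarith [tvDistance_nonneg π' π]

section Convergence

variable {Ω : Type u} [MeasurableSpace Ω] {P : Measure Ω}

lemma ProbabilityTheory.IndepFun.prodMk_left [IsProbabilityMeasure P] {α β γ : Type*} [MeasurableSpace α]
    [MeasurableSpace β] [MeasurableSpace γ] {A : Ω → α} {U : Ω → β} {V : Ω → γ}
    (hA : Measurable A) (hU : Measurable U) (hV : Measurable V)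
    (h : IndepFun A (fun ω => (U ω, V ω)) P) (h' : IndepFun U V P) :
    IndepFun (fun ω => (A ω, U ω)) V P := by
  have hAU : IndepFun A U P := h.comp measurable_id measurable_fst
  have := Measure.isProbabilityMeasure_map (μ := P) hA.aemeasurable
  have := Measure.isProbabilityMeasure_map (μ := P) hU.aemeasurable
  have := Measure.isProbabilityMeasure_map (μ := P) hV.aemeasurable
  rw [indepFun_iff_map_prod_eq_prod_map_map (by fun_prop) (by fun_prop)] at h h' hAU ⊢
  rw [hAU]
  rw [h', ← Measure.prodAssoc_prod] at h
  have := congrArg (Measure.map MeasurableEquiv.prodAssoc.symm) h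
  rw [Measure.map_map (by fun_prop) (by fun_prop)] at this
  rw [MeasurableEquiv.map_symm_map] at this
  exact this

lemma IsStorageProcess.measurable {K M : ℝ} {ν : Measure ℝ} {X B : ℕ → Ω → ℝ}
    (h : IsStorageProcess P K M ν X B) (i : ℕ) : Measurable (B i) := by
  induction i with
  | zero => exact h.measurable_init
  | succ i ih =>
    rw [show B (i + 1) = fun ω => bufferStep K M (B i ω) (X i ω) from funext (h.step i)]
    exact (measurable_bufferStep K M).comp (ih.prodMk (h.measurable_harvest i))

lemma IsStorageProcess.exists_eq {K M : ℝ} {ν : Measure ℝ} {X B : ℕ → Ω → ℝ}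
    (h : IsStorageProcess P K M ν X B) (i : ℕ) :
    ∃ φ : ℝ × (Finset.range i → ℝ) → ℝ, Measurable φ ∧
      ∀ ω, B i ω = φ (B 0 ω, fun j => X j ω) := by
  induction i with
  | zero => exact ⟨Prod.fst, measurable_fst, fun ω => rfl⟩
  | succ i ih =>
    obtain ⟨φ, hφ, e⟩ := ih
    refine ⟨fun p => bufferStep K M
      (φ (p.1, fun j => p.2 ⟨j, Finset.range_subset_range.2 (Nat.le_succ i) j.2⟩))
      (p.2 ⟨i, Finset.self_mem_range_succ i⟩), ?_, fun ω => ?_⟩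
    · refine (measurable_bufferStep K M).comp (Measurable.prodMk (hφ.comp ?_) ?_) <;> fun_prop
    · rw [h.step, e]

lemma IsStorageProcess.indepFun [IsProbabilityMeasure P] {K M : ℝ} {ν : Measure ℝ} {X B : ℕ → Ω → ℝ}
    (h : IsStorageProcess P K M ν X B) (i : ℕ) : IndepFun (B i) (X i) P := by
  have hX := h.measurable_harvest
  have h1 : IndepFun (fun ω (j : Finset.range i) => X j ω) (X i) P := by
    have := h.indep_harvest.indepFun_finset (Finset.range i) {i} (by simp) hX
    exact this.comp (φ := id)
      (ψ := fun p : ({i} : Finset ℕ) → ℝ => p ⟨i, Finset.mem_singleton_self i⟩)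
      measurable_id (by fun_prop)
  have h2 : IndepFun (B 0) (fun ω => ((fun j : Finset.range i => X j ω), X i ω)) P :=
    h.indep_init.comp (φ := id)
      (ψ := fun f : ℕ → ℝ => ((fun j : Finset.range i => f j), f i)) measurable_id (by fun_prop)
  have h3 := h2.prodMk_left h.measurable_init (by fun_prop) (hX i) h1
  obtain ⟨φ, hφ, e⟩ := h.exists_eq i
  rw [show B i = φ ∘ fun ω => (B 0 ω, fun j : Finset.range i => X j ω) from funext e]
  exact h3.comp hφ measurable_id

lemma IsStorageProcess.map_succ [IsProbabilityMeasure P] {K M : ℝ} {ν : Measure ℝ} {X B : ℕ → Ω → ℝ}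
    (h : IsStorageProcess P K M ν X B) (i : ℕ) :
    P.map (B (i + 1)) = bufferLaw K M ν (P.map (B i)) := by
  have h1 := (indepFun_iff_map_prod_eq_prod_map_map (h.measurable i).aemeasurable
    (h.measurable_harvest i).aemeasurable).1 (h.indepFun i)
  rw [h.law_harvest] at h1
  rw [bufferLaw, ← h1, Measure.map_map (measurable_bufferStep K M)
    ((h.measurable i).prodMk (h.measurable_harvest i))]
  exact congrArg (P.map ·) (funext (h.step i))

lemma IsStorageProcess.tendsto_tvDistance [IsProbabilityMeasure P] {K M : ℝ} {ν π : Measure ℝ} [IsProbabilityMeasure ν]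
    {X B : ℕ → Ω → ℝ} (hν : ν.real (Iio K) < 1) (hπ : IsStationaryDistribution K M ν π)
    (h : IsStorageProcess P K M ν X B) :
    Tendsto (fun i => tvDistance (P.map (B i)) π) atTop (𝓝 0) := by
  have := hπ.prob
  have (i : ℕ) : IsProbabilityMeasure (P.map (B i)) :=
    Measure.isProbabilityMeasure_map (h.measurable i).aemeasurable
  have hb (i : ℕ) : tvDistance (P.map (B i)) π ≤
      ν.real (Iio K) ^ i * tvDistance (P.map (B 0)) π := by
    induction i with
    | zero => simp
    | succ i ih =>
      have h1 := tvDistance_bufferLaw_le K M ν (P.map (B i)) π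
      rw [← h.map_succ, show bufferLaw K M ν π = π from hπ.invariant] at h1
      refine h1.trans ?_
      rw [pow_succ', mul_assoc]
      exact mul_le_mul_of_nonneg_left ih measureReal_nonneg
  refine squeeze_zero (fun i => tvDistance_nonneg _ _) hb ?_
  simpa using (tendsto_pow_atTop_nhds_zero_of_lt_one measureReal_nonneg hν).mul_const
    (tvDistance (P.map (B 0)) π)

end Convergence

/-- The part of the law of the storage level after `n` steps from the full level `K` that comes
from the event that no single harvest reaches `K`. -/
noncomputable def shortHarvestLaw (K M : ℝ) (ν : Measure ℝ) : ℕ → Measure ℝ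
  | 0 => Measure.dirac K
  | n + 1 => bufferLaw K M (ν.restrict (Iio K)) (shortHarvestLaw K M ν n)

section Existence

variable {K M : ℝ} {ν : Measure ℝ} [IsProbabilityMeasure ν]

lemma shortHarvestLaw_univ (n : ℕ) :
    shortHarvestLaw K M ν n univ = ν (Iio K) ^ n := by
  induction n with
  | zero => simp [shortHarvestLaw]
  | succ n ih =>
    rw [shortHarvestLaw, bufferLaw_apply _ _ _ _ MeasurableSet.univ]
    simp [ih, pow_succ']

lemma shortHarvestLaw_compl (hK : 0 ≤ K) (hν0 : ν (Iio 0) = 0) (n : ℕ) :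
    shortHarvestLaw K M ν n (Icc 0 K)ᶜ = 0 := by
  cases n with
  | zero => simp [shortHarvestLaw, hK]
  | succ n =>
    rw [shortHarvestLaw, bufferLaw_apply _ _ _ _ measurableSet_Icc.compl]
    have (b : ℝ) : (ν.restrict (Iio K)) {e | bufferStep K M b e ∈ (Icc 0 K)ᶜ} = 0 := by
      refine measure_mono_null ?_ (Measure.absolutelyContinuous_of_le Measure.restrict_le_self hν0)
      intro e he
      by_contra h
      exact he ⟨le_min (add_nonneg (le_max_right _ _) (not_lt.1 h)) hK, min_le_right _ _⟩
    simp_rw [this]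
    simp

lemma exists_isStationaryDistribution (hK : 0 ≤ K) (hν0 : ν (Iio 0) = 0) (hν : ν (Ici K) ≠ 0) :
    ∃ π, IsStationaryDistribution K M ν π := by
  have hsum : ν (Iio K) + ν (Ici K) = 1 := by
    rw [← compl_Iio, measure_add_measure_compl measurableSet_Iio, measure_univ]
  have hsub : 1 - ν (Iio K) = ν (Ici K) := by
    rw [← hsum]; exact ENNReal.add_sub_cancel_left (measure_ne_top _ _)
  have hcancel : ν (Ici K) * (ν (Ici K))⁻¹ = 1 := ENNReal.mul_inv_cancel hν (measure_ne_top _ _)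
  have huniv : (ν (Ici K) • Measure.sum (shortHarvestLaw K M ν)) univ = 1 := by
    simp [Measure.sum_apply, shortHarvestLaw_univ, ENNReal.tsum_geometric, hsub, hcancel]
  refine ⟨ν (Ici K) • Measure.sum (shortHarvestLaw K M ν), ⟨huniv⟩, ?_, ?_⟩
  · simp [Measure.sum_apply, measurableSet_Icc, shortHarvestLaw_compl hK hν0]
  · ext A hA
    have hsplit (b : ℝ) : ν {e | bufferStep K M b e ∈ A} =
        (ν.restrict (Iio K)) {e | bufferStep K M b e ∈ A} +
          ν (Ici K) * Measure.dirac K A := by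
      have hS : MeasurableSet {e | bufferStep K M b e ∈ A} := measurable_bufferStep_right K M b hA
      rw [← measure_inter_add_sdiff _ measurableSet_Iio, Measure.restrict_apply hS]
      congr 1
      rw [sdiff_eq, compl_Iio, Measure.dirac_apply' _ hA]
      by_cases hk : K ∈ A
      · have h : {e | bufferStep K M b e ∈ A} ∩ Ici K = Ici K :=
          inter_eq_right.2 fun e (he : K ≤ e) =>
            show bufferStep K M b e ∈ A by rwa [bufferStep_of_le he]
        simp [h, hk]
      · rw [show {e | bufferStep K M b e ∈ A} ∩ Ici K = ∅ from by
          ext e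
          simp only [mem_inter_iff, mem_ofPred_eq, mem_Ici, mem_empty_iff_false, iff_false, not_and]
          exact fun h1 h2 => hk (by rwa [bufferStep_of_le h2] at h1)]
        simp [hk]
    refine (bufferLaw_apply K M ν _ hA).trans ?_
    simp_rw [hsplit]
    rw [lintegral_add_right _ measurable_const, lintegral_const, huniv, mul_one,
      lintegral_smul_measure, lintegral_sum_measure, Measure.smul_apply,
      Measure.sum_apply _ hA, tsum_eq_zero_add' (f := fun n => shortHarvestLaw K M ν n A)
        ENNReal.summable, smul_eq_mul, smul_eq_mul, mul_add, add_comm]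
    congr 2
    refine tsum_congr fun n => ?_
    rw [shortHarvestLaw, bufferLaw_apply _ _ _ _ hA]

end Existence

section Exponential

variable {lam : ℝ}

lemma expMeasure_Iio_zero : expMeasure lam (Iio 0) = 0 := by
  rw [expMeasure, gammaMeasure, withDensity_apply _ measurableSet_Iio]
  exact lintegral_gammaPDF_of_nonpos le_rfl

lemma expMeasure_Ici (hlam : 0 < lam) {a : ℝ} (ha : 0 ≤ a) :
    expMeasure lam (Ici a) = ENNReal.ofReal (Real.exp (-(lam * a))) := by
  have := isProbabilityMeasure_expMeasure hlam
  have hna : expMeasure lam {a} = 0 := by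
    rw [expMeasure, gammaMeasure, withDensity_apply _ (measurableSet_singleton a)]
    simp
  have h1 : expMeasure lam (Ici a) = expMeasure lam (Ioi a) := by
    rw [← Ioi_insert, insert_eq]
    refine le_antisymm ((measure_union_le _ _).trans (by simp [hna])) (measure_mono (by simp))
  have h2 : (expMeasure lam).real (Iic a) = 1 - Real.exp (-(lam * a)) := by
    rw [← cdf_eq_real, cdf_expMeasure_eq hlam, if_pos ha]
  rw [h1, ← compl_Iic, ← ofReal_measureReal, probReal_compl_eq_one_sub measurableSet_Iic, h2]
  ring_nf

lemma expMeasure_translate (lam m : ℝ) {S : Set ℝ} (hS : MeasurableSet S) :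
    expMeasure lam {e | m + e ∈ S} = ∫⁻ x in S, exponentialPDF lam (x - m) := by
  have hS' : MeasurableSet {e | m + e ∈ S} := (measurable_const_add m) hS
  rw [expMeasure, gammaMeasure, withDensity_apply _ hS', ← lintegral_indicator hS',
    ← lintegral_indicator hS,
    ← lintegral_sub_right_eq_self ({e | m + e ∈ S}.indicator (gammaPDF 1 lam)) m]
  refine lintegral_congr fun x => ?_
  have hiff : x - m ∈ {e | m + e ∈ S} ↔ x ∈ S := by
    change m + (x - m) ∈ S ↔ x ∈ S
    rw [add_sub_cancel]
  by_cases hx : x ∈ S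
  · rw [indicator_of_mem hx, indicator_of_mem (hiff.2 hx)]
    rfl
  · rw [indicator_of_notMem hx, indicator_of_notMem (hiff.not.2 hx)]

end Exponential

/-- The stationary density below the full level, multiplied by `exp (lam * x)`. -/
noncomputable def tiltedDensity (M lam : ℝ) (π : Measure ℝ) (x : ℝ) : ℝ :=
  lam * ∫ u in Iic (x + M), Real.exp (lam * max (u - M) 0) ∂π

/-- The stationary density below the full level. -/
noncomputable def bufferDensity (M lam : ℝ) (π : Measure ℝ) (x : ℝ) : ℝ :=
  Real.exp (-(lam * x)) * tiltedDensity M lam π x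

section Density

variable {K M lam : ℝ} {π : Measure ℝ}

lemma IsStationaryDistribution.ae_mem_Icc {ν : Measure ℝ}
    (h : IsStationaryDistribution K M ν π) : ∀ᵐ u ∂π, u ∈ Icc 0 K := h.support

lemma IsStationaryDistribution.apply_eq {ν : Measure ℝ} [SFinite ν]
    (h : IsStationaryDistribution K M ν π) {A : Set ℝ} (hA : MeasurableSet A) :
    π A = ∫⁻ b, ν {e | bufferStep K M b e ∈ A} ∂π := by
  conv_lhs => rw [← show bufferLaw K M ν π = π from h.invariant]
  exact bufferLaw_apply K M ν π hA

lemma IsStationaryDistribution.integrable_exp {ν : Measure ℝ} (hK : 0 < K) (hM : 0 < M)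
    (hlam : 0 < lam) (h : IsStationaryDistribution K M ν π) :
    Integrable (fun u => Real.exp (lam * max (u - M) 0)) π := by
  have := h.prob
  refine Integrable.of_bound (by fun_prop) (Real.exp (lam * K)) ?_
  filter_upwards [h.ae_mem_Icc] with u hu
  rw [Real.norm_of_nonneg (Real.exp_pos _).le, Real.exp_le_exp]
  exact mul_le_mul_of_nonneg_left (max_le (by linarith [hu.2]) hK.le) hlam.le

lemma tiltedDensity_nonneg (hlam : 0 < lam) (x : ℝ) : 0 ≤ tiltedDensity M lam π x :=
  mul_nonneg hlam.le (integral_nonneg fun _ => (Real.exp_pos _).le)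

lemma bufferDensity_nonneg (hlam : 0 < lam) (x : ℝ) : 0 ≤ bufferDensity M lam π x :=
  mul_nonneg (Real.exp_pos _).le (tiltedDensity_nonneg hlam x)

lemma IsStationaryDistribution.measurable_tiltedDensity {ν : Measure ℝ} (hK : 0 < K) (hM : 0 < M)
    (hlam : 0 < lam) (h : IsStationaryDistribution K M ν π) :
    Measurable (tiltedDensity M lam π) := by
  refine Monotone.measurable fun x y hxy => ?_
  refine mul_le_mul_of_nonneg_left ?_ hlam.le
  exact setIntegral_mono_set (h.integrable_exp hK hM hlam).integrableOn
    (ae_of_all _ fun _ => (Real.exp_pos _).le)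
    (LE.le.eventuallyLE (Iic_subset_Iic.2 (by linarith)))

lemma IsStationaryDistribution.measurable_bufferDensity {ν : Measure ℝ} (hK : 0 < K) (hM : 0 < M)
    (hlam : 0 < lam) (h : IsStationaryDistribution K M ν π) :
    Measurable (bufferDensity M lam π) := by
  have := h.measurable_tiltedDensity hK hM hlam
  unfold bufferDensity
  fun_prop

lemma IsStationaryDistribution.lintegral_pdf {ν : Measure ℝ} (hK : 0 < K) (hM : 0 < M)
    (hlam : 0 < lam) (h : IsStationaryDistribution K M ν π) (x : ℝ) :
    ∫⁻ u, exponentialPDF lam (x - max (u - M) 0) ∂π =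
      (Ici 0).indicator (fun x => ENNReal.ofReal (bufferDensity M lam π x)) x := by
  by_cases hx : 0 ≤ x
  · rw [indicator_of_mem (show x ∈ Ici 0 from hx), bufferDensity, tiltedDensity, ← mul_assoc,
      ← integral_const_mul, ofReal_integral_eq_lintegral_ofReal
        ((h.integrable_exp hK hM hlam).integrableOn.const_mul _)
        (ae_of_all _ fun u => by simp only [Pi.zero_apply]; positivity),
      ← lintegral_indicator measurableSet_Iic]
    refine lintegral_congr fun u => ?_
    by_cases hu : u ≤ x + M
    · rw [indicator_of_mem (show u ∈ Iic (x + M) from hu), exponentialPDF_of_nonneg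
        (sub_nonneg.2 (max_le (by linarith) hx)), mul_comm (Real.exp _) lam, mul_assoc,
        ← Real.exp_add]
      ring_nf
    · rw [indicator_of_notMem (show u ∉ Iic (x + M) from hu), exponentialPDF_of_neg]
      have := le_max_left (u - M) 0
      linarith [not_le.1 hu]
  · rw [indicator_of_notMem (show x ∉ Ici 0 from hx)]
    refine (lintegral_congr fun u => ?_).trans lintegral_zero
    refine exponentialPDF_of_neg ?_
    have := le_max_right (u - M) 0
    linarith [not_le.1 hx]

lemma IsStationaryDistribution.restrict_Iio (hK : 0 < K) (hM : 0 < M)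
    (hlam : 0 < lam) (h : IsStationaryDistribution K M (expMeasure lam) π) :
    π.restrict (Iio K) = (volume.restrict (Ioo 0 K)).withDensity
      (fun x => ENNReal.ofReal (bufferDensity M lam π x)) := by
  have := h.prob
  have := isProbabilityMeasure_expMeasure hlam
  ext A hA
  have hS : MeasurableSet (A ∩ Iio K) := hA.inter measurableSet_Iio
  have hstep (u : ℝ) : {e | bufferStep K M u e ∈ A ∩ Iio K} =
      {e | max (u - M) 0 + e ∈ A ∩ Iio K} := by
    ext e
    change _ ∈ A ∩ Iio K ↔ _ ∈ A ∩ Iio K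
    by_cases he : max (u - M) 0 + e < K
    · rw [bufferStep, min_eq_left he.le]
    · rw [bufferStep, min_eq_right (not_lt.1 he)]
      simp [he]
  have hmeas : Measurable (fun p : ℝ × ℝ => exponentialPDF lam (p.2 - max (p.1 - M) 0)) := by
    unfold exponentialPDF
    fun_prop
  rw [Measure.restrict_apply hA, h.apply_eq hS]
  simp_rw [hstep, expMeasure_translate lam _ hS]
  rw [lintegral_lintegral_swap hmeas.aemeasurable]
  simp_rw [h.lintegral_pdf hK hM hlam]
  have h0 : (Ici (0:ℝ)).indicator (fun x => ENNReal.ofReal (bufferDensity M lam π x))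
      =ᵐ[volume.restrict (A ∩ Iio K)]
      (Ioi (0:ℝ)).indicator (fun x => ENNReal.ofReal (bufferDensity M lam π x)) :=
    ae_restrict_of_ae (indicator_ae_eq_of_ae_eq_set Ioi_ae_eq_Ici.symm)
  rw [lintegral_congr_ae h0, lintegral_indicator measurableSet_Ioi,
    withDensity_apply _ hA, Measure.restrict_restrict measurableSet_Ioi,
    Measure.restrict_restrict hA, inter_left_comm, Ioi_inter_Iio]

lemma IsStationaryDistribution.eq_withDensity_add_dirac (hK : 0 < K) (hM : 0 < M)
    (hlam : 0 < lam) (h : IsStationaryDistribution K M (expMeasure lam) π) :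
    π = (volume.restrict (Ioo 0 K)).withDensity
      (fun x => ENNReal.ofReal (bufferDensity M lam π x)) + π {K} • Measure.dirac K := by
  rw [← h.restrict_Iio hK hM hlam, ← Measure.restrict_singleton,
    ← Measure.restrict_congr_set (s := Ici K) (t := {K}), ← compl_Iio,
    Measure.restrict_add_restrict_compl measurableSet_Iio]
  filter_upwards [h.ae_mem_Icc] with u hu
  exact propext ⟨fun (h1 : K ≤ u) => le_antisymm hu.2 h1, fun (h1 : u = K) => h1.ge⟩

lemma IsStationaryDistribution.real_singleton (hK : 0 < K) (hM : 0 < M)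
    (hlam : 0 < lam) (h : IsStationaryDistribution K M (expMeasure lam) π) :
    π.real {K} = Real.exp (-(lam * K)) * ∫ u, Real.exp (lam * max (u - M) 0) ∂π := by
  have := h.prob
  have := isProbabilityMeasure_expMeasure hlam
  rw [Measure.real, h.apply_eq (measurableSet_singleton K), ← integral_const_mul,
    ← ENNReal.toReal_ofReal (integral_nonneg fun u => by positivity),
    ofReal_integral_eq_lintegral_ofReal ((h.integrable_exp hK hM hlam).const_mul _)
      (ae_of_all _ fun u => by simp only [Pi.zero_apply]; positivity)]
  congr 1
  refine lintegral_congr_ae ?_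
  filter_upwards [h.ae_mem_Icc] with u hu
  rw [show {e | bufferStep K M u e ∈ ({K} : Set ℝ)} = Ici (K - max (u - M) 0) from by
    ext e
    change min (max (u - M) 0 + e) K = K ↔ K - max (u - M) 0 ≤ e
    rw [min_eq_right_iff, sub_le_iff_le_add'],
    expMeasure_Ici hlam (sub_nonneg.2 (max_le (by linarith [hu.2]) hK.le)), ← Real.exp_add]
  ring_nf

lemma IsStationaryDistribution.setIntegral_Iio (hK : 0 < K) (hM : 0 < M)
    (hlam : 0 < lam) (h : IsStationaryDistribution K M (expMeasure lam) π) (f : ℝ → ℝ) :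
    ∫ u in Iio K, f u ∂π = ∫ u in Ioo 0 K, bufferDensity M lam π u * f u := by
  rw [h.restrict_Iio hK hM hlam, integral_withDensity_eq_integral_toReal_smul
    (h.measurable_bufferDensity hK hM hlam).ennreal_ofReal (ae_of_all _ fun _ => by simp)]
  simp_rw [ENNReal.toReal_ofReal (bufferDensity_nonneg hlam _), smul_eq_mul]

lemma IsStationaryDistribution.integral_bufferDensity (hK : 0 < K) (hM : 0 < M)
    (hlam : 0 < lam) (h : IsStationaryDistribution K M (expMeasure lam) π) :
    (∫ u in Ioo 0 K, bufferDensity M lam π u) + π.real {K} = 1 := by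
  have := h.prob
  have h1 := h.setIntegral_Iio hK hM hlam (fun _ => 1)
  simp only [mul_one] at h1
  rw [← h1, setIntegral_const, smul_eq_mul, mul_one, ← measureReal_union (by simp) (by simp),
    Iio_union_right, ← probReal_univ (μ := π)]
  refine measureReal_congr ?_
  filter_upwards [h.ae_mem_Icc] with u hu
  exact propext ⟨fun _ => trivial, fun _ => hu.2⟩

lemma IsStationaryDistribution.integral_exp_eq (hK : 0 < K) (hM : 0 < M)
    (hlam : 0 < lam) (h : IsStationaryDistribution K M (expMeasure lam) π) :
    ∫ u, Real.exp (lam * max (u - M) 0) ∂π = π.real {K} * Real.exp (lam * K) := by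
  rw [h.real_singleton hK hM hlam, mul_right_comm, ← Real.exp_add]
  simp

lemma IsStationaryDistribution.tiltedDensity_of_le (hK : 0 < K) (hM : 0 < M)
    (hlam : 0 < lam) (h : IsStationaryDistribution K M (expMeasure lam) π) {x : ℝ}
    (hx : K - M ≤ x) : tiltedDensity M lam π x = lam * (π.real {K} * Real.exp (lam * K)) := by
  rw [tiltedDensity, ← h.integral_exp_eq hK hM hlam, Measure.restrict_eq_self_of_ae_mem]
  filter_upwards [h.ae_mem_Icc] with u hu
  exact hu.2.trans (by linarith)

lemma IsStationaryDistribution.tiltedDensity_of_lt (hK : 0 < K) (hM : 0 < M)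
    (hlam : 0 < lam) (h : IsStationaryDistribution K M (expMeasure lam) π) {x : ℝ}
    (hx0 : 0 ≤ x) (hx : x < K - M) :
    tiltedDensity M lam π x = lam * (π.real {K} * Real.exp (lam * K)) -
      lam * Real.exp (-(lam * M)) * (π.real {K} * Real.exp (lam * K) +
        ∫ u in Ioo (x + M) K, tiltedDensity M lam π u) := by
  have := h.prob
  have hi := h.integrable_exp hK hM hlam
  have hsplit := integral_add_compl (measurableSet_Iic (a := x + M)) hi
  rw [h.integral_exp_eq hK hM hlam, compl_Iic] at hsplit
  have hsets : Ioi (x + M) =ᵐ[π] (Ioo (x + M) K ∪ {K} : Set ℝ) := by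
    filter_upwards [h.ae_mem_Icc] with u hu
    refine propext ⟨fun (h1 : x + M < u) => ?_, ?_⟩
    · rcases hu.2.lt_or_eq with h2 | h2
      · exact Or.inl ⟨h1, h2⟩
      · exact Or.inr h2
    · rintro (h1 | h1)
      · exact h1.1
      · change x + M < u
        rw [show u = K from h1]
        linarith
  have hupper : ∫ u in Ioi (x + M), Real.exp (lam * max (u - M) 0) ∂π =
      Real.exp (-(lam * M)) * (π.real {K} * Real.exp (lam * K) +
        ∫ u in Ioo (x + M) K, tiltedDensity M lam π u) := by
    rw [setIntegral_congr_set hsets, setIntegral_union (by simp) (by simp) hi.integrableOn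
      hi.integrableOn, integral_singleton, max_eq_left (by linarith), smul_eq_mul, mul_add,
      ← integral_const_mul, add_comm]
    congr 1
    · rw [mul_sub, sub_eq_add_neg, Real.exp_add]
      ring
    · have h1 : Ioo (x + M) K ⊆ Ioo 0 K := Ioo_subset_Ioo_left (by linarith)
      have h2 := h.setIntegral_Iio hK hM hlam
        ((Ioo (x + M) K).indicator fun u => Real.exp (lam * max (u - M) 0))
      rw [setIntegral_indicator measurableSet_Ioo,
        inter_eq_right.2 (show Ioo (x + M) K ⊆ Iio K from fun u hu => hu.2)] at h2
      rw [h2]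
      simp_rw [← indicator_mul_right (Ioo (x + M) K) (bufferDensity M lam π)]
      rw [setIntegral_indicator measurableSet_Ioo, inter_eq_right.2 h1]
      refine setIntegral_congr_fun measurableSet_Ioo fun u hu => ?_
      rw [max_eq_left (by linarith [hu.1]), bufferDensity, mul_right_comm, ← Real.exp_add]
      ring_nf
  rw [tiltedDensity, eq_sub_of_add_eq hsplit, hupper]
  ring

end Density

/-- The `q`-th term of the solution of `w' (y) = -lam * exp (-δ) * w (y - M)`. -/
noncomputable def delayTerm (lam δ : ℝ) (q : ℕ) (y : ℝ) : ℝ :=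
  (-Real.exp (-δ)) ^ q / (q.factorial : ℝ) *
    ((lam * y - δ * q) ^ q + q * (lam * y - δ * q) ^ (q - 1))

/-- The antiderivative of `lam * exp (lam * y) * delayTerm lam δ q y` that vanishes at
`δ * q / lam`, if `q ≠ 0`. -/
noncomputable def delayMass (lam δ : ℝ) (q : ℕ) (y : ℝ) : ℝ :=
  (-Real.exp (-δ)) ^ q / (q.factorial : ℝ) * ((lam * y - δ * q) ^ q * Real.exp (lam * y))

/-- The solution of the delay equation `w' (y) = -lam * exp (-δ) * w (y - M)`, with `N` terms. -/
noncomputable def delayProfile (M lam δ : ℝ) (N : ℕ) (y : ℝ) : ℝ :=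
  ∑ q ∈ Finset.range N, (Ioi (q * M)).indicator (delayTerm lam δ q) y

section Delay

variable {K M lam δ : ℝ}

@[simp]
lemma delayTerm_zero (y : ℝ) : delayTerm lam δ 0 y = 1 := by simp [delayTerm]

lemma continuous_delayTerm (q : ℕ) : Continuous (delayTerm lam δ q) := by
  unfold delayTerm; fun_prop

lemma hasDerivAt_delayMass (q : ℕ) (y : ℝ) :
    HasDerivAt (delayMass lam δ q) (lam * Real.exp (lam * y) * delayTerm lam δ q y) y := by
  have h1 : HasDerivAt (fun y => lam * y) lam y := by
    simpa using (hasDerivAt_id y).const_mul lam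
  have h := (((h1.sub_const (δ * q)).fun_pow q).mul h1.exp).const_mul
    ((-Real.exp (-δ)) ^ q / (q.factorial : ℝ))
  refine h.congr_deriv ?_
  rw [delayTerm]
  ring

lemma hasDerivAt_delayTerm_succ (hδ : δ = lam * M) (q : ℕ) (y : ℝ) :
    HasDerivAt (fun y => delayTerm lam δ (q + 1) (y + M))
      (-(lam * Real.exp (-δ)) * delayTerm lam δ q y) y := by
  have h1 : HasDerivAt (fun y => lam * (y + M) - δ * ((q + 1 : ℕ) : ℝ)) lam y := by
    simpa using (((hasDerivAt_id y).add_const M).const_mul lam).sub_const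
      (δ * ((q + 1 : ℕ) : ℝ))
  have h := ((h1.fun_pow (q + 1)).add ((h1.fun_pow q).const_mul ((q + 1 : ℕ) : ℝ))).const_mul
    ((-Real.exp (-δ)) ^ (q + 1) / ((q + 1).factorial : ℝ))
  refine h.congr_deriv ?_
  have hq : (q.factorial : ℝ) ≠ 0 := by positivity
  have hq1 : (q : ℝ) + 1 ≠ 0 := by positivity
  rw [delayTerm, Nat.factorial_succ, show lam * (y + M) - δ * ((q + 1 : ℕ) : ℝ) = lam * y - δ * q by
    rw [hδ]; push_cast; ring]
  push_cast
  field_simp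
  ring

lemma delayTerm_succ_left (hδ : δ = lam * M) (q : ℕ) :
    delayTerm lam δ (q + 1) (q * M + M) = if q = 0 then -Real.exp (-δ) else 0 := by
  rw [delayTerm, show lam * (q * M + M) - δ * ((q + 1 : ℕ) : ℝ) = 0 by
    rw [hδ]; push_cast; ring]
  split_ifs with h
  · subst h; simp
  · simp [h]

lemma delayMass_left (hδ : δ = lam * M) (q : ℕ) :
    delayMass lam δ q (q * M) = if q = 0 then 1 else 0 := by
  rw [delayMass, show lam * (q * M) - δ * q = 0 by rw [hδ]; ring]
  split_ifs with h
  · subst h; simp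
  · simp [h]

lemma integrableOn_indicator_delayTerm (f : ℝ → ℝ) (hf : Continuous f) (q : ℕ) (z : ℝ) :
    IntegrableOn (fun v => f v * (Ioi (q * M)).indicator (delayTerm lam δ q) v) (Ioo 0 z) := by
  simp_rw [← indicator_mul_right (Ioi (q * M)) f]
  refine IntegrableOn.indicator ?_ measurableSet_Ioi
  exact ((hf.mul (continuous_delayTerm q)).continuousOn.integrableOn_Icc).mono_set Ioo_subset_Icc_self

lemma setIntegral_indicator_delayTerm (hM : 0 < M) (f F : ℝ → ℝ) (hf : Continuous f) (q : ℕ)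
    (hF : ∀ v, HasDerivAt F (f v * delayTerm lam δ q v) v) (z : ℝ) :
    ∫ v in Ioo 0 z, f v * (Ioi (q * M)).indicator (delayTerm lam δ q) v =
      if q * M < z then F z - F (q * M) else 0 := by
  have hq : 0 ≤ q * M := by positivity
  simp_rw [← indicator_mul_right (Ioi (q * M)) f]
  rw [setIntegral_indicator measurableSet_Ioi, Ioo_inter_Ioi, max_eq_right hq]
  split_ifs with h
  · rw [← integral_Ioc_eq_integral_Ioo, ← intervalIntegral.integral_of_le h.le]
    exact intervalIntegral.integral_eq_sub_of_hasDerivAt (fun v _ => hF v)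
      ((hf.mul (continuous_delayTerm q)).intervalIntegrable _ _)
  · rw [Ioo_eq_empty h]; simp

lemma setIntegral_mul_delayProfile (f : ℝ → ℝ) (hf : Continuous f) (N : ℕ) (z : ℝ) :
    ∫ v in Ioo 0 z, f v * delayProfile M lam δ N v =
      ∑ q ∈ Finset.range N,
        ∫ v in Ioo 0 z, f v * (Ioi (q * M)).indicator (delayTerm lam δ q) v := by
  simp_rw [delayProfile, Finset.mul_sum]
  exact integral_finsetSum _ fun q _ => integrableOn_indicator_delayTerm f hf q z

lemma delayProfile_add (hM : 0 < M) (hδ : δ = lam * M) (N : ℕ) {z : ℝ} (hz : 0 < z) :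
    -(lam * Real.exp (-δ)) * ∫ v in Ioo 0 z, delayProfile M lam δ (N + 1) v =
      delayProfile M lam δ (N + 2) (z + M) - 1 + Real.exp (-δ) := by
  rw [← integral_const_mul, setIntegral_mul_delayProfile _ continuous_const,
    Finset.sum_congr rfl fun q _ => setIntegral_indicator_delayTerm hM
      (fun _ => -(lam * Real.exp (-δ))) _ continuous_const q (hasDerivAt_delayTerm_succ hδ q) z,
    delayProfile, Finset.sum_range_succ' _ (N + 1)]
  have h0 : (Ioi (((0 : ℕ) : ℝ) * M)).indicator (delayTerm lam δ 0) (z + M) = 1 := by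
    rw [indicator_of_mem (show z + M ∈ Ioi (((0 : ℕ) : ℝ) * M) by
      rw [mem_Ioi]; push_cast; linarith), delayTerm_zero]
  have hq (q : ℕ) : (Ioi (((q + 1 : ℕ) : ℝ) * M)).indicator (delayTerm lam δ (q + 1)) (z + M) =
      if q * M < z then delayTerm lam δ (q + 1) (z + M) else 0 := by
    rw [indicator_apply]
    refine if_congr ?_ rfl rfl
    rw [mem_Ioi]
    push_cast
    constructor <;> intro <;> linarith
  have hd (q : ℕ) : (if q * M < z then
      delayTerm lam δ (q + 1) (z + M) - delayTerm lam δ (q + 1) (q * M + M) else 0) =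
      (if q * M < z then delayTerm lam δ (q + 1) (z + M) else 0) +
        if q = 0 then Real.exp (-δ) else 0 := by
    rw [delayTerm_succ_left hδ]
    by_cases h : q = 0
    · subst h
      simp [hz]
    · simp [h]
  simp_rw [hd, hq, h0]
  rw [Finset.sum_add_distrib, Finset.sum_ite_eq' (Finset.range (N + 1)) 0]
  simp

lemma delayProfile_succ_of_le {N : ℕ} {y : ℝ} (hy : y ≤ N * M) :
    delayProfile M lam δ (N + 1) y = delayProfile M lam δ N y := by
  rw [delayProfile, Finset.sum_range_succ, indicator_of_notMem (by simpa using hy), add_zero]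
  rfl

lemma delayProfile_of_mem (hM : 0 < M) {n N : ℕ} (hn : n < N) {y : ℝ} (hy : n * M < y)
    (hy' : y ≤ (n + 1) * M) :
    delayProfile M lam δ N y = ∑ q ∈ Finset.range (n + 1), delayTerm lam δ q y := by
  have hsub : Finset.range (n + 1) ⊆ Finset.range N := Finset.range_subset_range.2 hn
  rw [delayProfile, ← Finset.sum_subset hsub]
  · refine Finset.sum_congr rfl fun q hq => indicator_of_mem ?_ _
    have : (q : ℝ) ≤ n := by exact_mod_cast Nat.lt_succ_iff.1 (Finset.mem_range.1 hq)
    exact lt_of_le_of_lt (mul_le_mul_of_nonneg_right this hM.le) hy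
  · intro q _ hq
    refine indicator_of_notMem ?_ _
    have : (n : ℝ) + 1 ≤ q := by exact_mod_cast not_lt.1 (fun h => hq (Finset.mem_range.2 h))
    simp only [mem_Ioi, not_lt]
    exact hy'.trans (mul_le_mul_of_nonneg_right this hM.le)

lemma sum_range_delayTerm (n : ℕ) (y : ℝ) :
    ∑ q ∈ Finset.range (n + 1), delayTerm lam δ q y =
      1 + ∑ q ∈ Finset.Icc 1 n, Real.exp (-δ * q) / (Nat.factorial (q - 1) : ℝ) *
        (δ * q - lam * y) ^ (q - 1) * (-(lam * y) / q + δ - 1) := by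
  rw [Finset.sum_range_succ', delayTerm_zero, add_comm, Finset.range_eq_Ico,
    Finset.sum_Ico_add' (fun q => delayTerm lam δ q y) 0 n 1]
  congr 1
  refine Finset.sum_congr (by ext; simp) fun q hq => ?_
  obtain ⟨r, rfl⟩ := Nat.exists_eq_add_of_le' (Finset.mem_Icc.1 hq).1
  have hr : (r.factorial : ℝ) ≠ 0 := by positivity
  have hr1 : (r : ℝ) + 1 ≠ 0 := by positivity
  rw [delayTerm, neg_pow, ← Real.exp_nat_mul, Nat.factorial_succ,
    ← neg_sub (δ * ((r + 1 : ℕ) : ℝ)) (lam * y), neg_pow (δ * _ - _), Nat.add_sub_cancel,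
    neg_pow (δ * _ - _) r, mul_comm _ (-δ)]
  push_cast
  field_simp
  ring_nf
  simp only [mul_comm r 2, pow_mul, neg_one_sq, one_pow]
  ring

end Delay

lemma setIntegral_Ioo_sub_left (f : ℝ → ℝ) (d : ℝ) {a b : ℝ} (hab : a ≤ b) :
    ∫ x in Ioo a b, f (d - x) = ∫ x in Ioo (d - b) (d - a), f x := by
  rw [← integral_Ioc_eq_integral_Ioo, ← integral_Ioc_eq_integral_Ioo,
    ← intervalIntegral.integral_of_le hab, ← intervalIntegral.integral_of_le (by linarith),
    intervalIntegral.integral_comp_sub_left]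

section Solution

variable {K M lam δ : ℝ} {π : Measure ℝ}

lemma IsStationaryDistribution.tiltedDensity_eq_delayProfile (hK : 0 < K) (hM : 0 < M)
    (hlam : 0 < lam) (hδ : δ = lam * M)
    (h : IsStationaryDistribution K M (expMeasure lam) π) {N : ℕ} (hN : K ≤ (N + 1) * M)
    {y : ℝ} (hy0 : 0 < y) (hyK : y ≤ K) :
    tiltedDensity M lam π (K - y) =
      lam * (π.real {K} * Real.exp (lam * K)) * delayProfile M lam δ (N + 1) y := by
  suffices H : ∀ n : ℕ, ∀ y, 0 < y → y ≤ K → y ≤ (n + 1) * M → tiltedDensity M lam π (K - y) =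
      lam * (π.real {K} * Real.exp (lam * K)) * delayProfile M lam δ (N + 1) y from
    H N y hy0 hyK (hyK.trans hN)
  have hfirst : ∀ y, 0 < y → y ≤ M → tiltedDensity M lam π (K - y) =
      lam * (π.real {K} * Real.exp (lam * K)) * delayProfile M lam δ (N + 1) y := by
    intro y h0 h1
    rw [h.tiltedDensity_of_le hK hM hlam (by linarith),
      delayProfile_of_mem hM (Nat.succ_pos N) (by simpa using h0) (by simpa using h1)]
    simp
  intro n
  induction n with
  | zero => exact fun y h0 _ h1 => hfirst y h0 (by simpa using h1)
  | succ n ih =>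
    intro y h0 hyK hy
    rcases le_or_gt y M with hyM | hyM
    · exact hfirst y h0 hyM
    push_cast at hy
    have hz : 0 < y - M := by linarith
    have hint : ∫ u in Ioo (K - y + M) K, tiltedDensity M lam π u =
        lam * (π.real {K} * Real.exp (lam * K)) *
          ∫ v in Ioo 0 (y - M), delayProfile M lam δ (N + 1) v := by
      have h1 := setIntegral_Ioo_sub_left (tiltedDensity M lam π) K hz.le
      rw [sub_zero, show K - (y - M) = K - y + M by ring] at h1
      rw [← h1, ← integral_const_mul]
      refine setIntegral_congr_fun measurableSet_Ioo fun v hv => ?_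
      exact ih v hv.1 (by linarith [hv.2]) (by linarith [hv.2])
    have hprof := delayProfile_add hM hδ N hz
    rw [sub_add_cancel, delayProfile_succ_of_le (N := N + 1) (by push_cast; linarith)] at hprof
    rw [h.tiltedDensity_of_lt hK hM hlam (by linarith) (by linarith), hint, ← hδ]
    linear_combination (lam * (π.real {K} * Real.exp (lam * K))) * hprof

lemma IsStationaryDistribution.bufferDensity_eq_delayProfile (hK : 0 < K) (hM : 0 < M)
    (hlam : 0 < lam) (hδ : δ = lam * M)
    (h : IsStationaryDistribution K M (expMeasure lam) π) {N : ℕ} (hN : K ≤ (N + 1) * M)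
    {y : ℝ} (hy0 : 0 < y) (hyK : y ≤ K) :
    bufferDensity M lam π (K - y) =
      π.real {K} * (lam * Real.exp (lam * y) * delayProfile M lam δ (N + 1) y) := by
  rw [bufferDensity, h.tiltedDensity_eq_delayProfile hK hM hlam hδ hN hy0 hyK,
    show lam * y = -(lam * (K - y)) + lam * K by ring, Real.exp_add]
  ring

lemma IsStationaryDistribution.real_singleton_mul_sum (hK : 0 < K) (hM : 0 < M)
    (hlam : 0 < lam) (hδ : δ = lam * M)
    (h : IsStationaryDistribution K M (expMeasure lam) π) {N : ℕ} (hN : K ≤ (N + 1) * M)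
    (hN' : N * M ≤ K) :
    π.real {K} * ∑ q ∈ Finset.range (N + 1), delayMass lam δ q K = 1 := by
  have h1 := setIntegral_Ioo_sub_left (bufferDensity M lam π) K hK.le
  rw [sub_zero, sub_self] at h1
  have hmass : ∫ u in Ioo 0 K, bufferDensity M lam π u =
      π.real {K} * (∑ q ∈ Finset.range (N + 1), delayMass lam δ q K - 1) := by
    rw [← h1, setIntegral_congr_fun measurableSet_Ioo fun y hy =>
        h.bufferDensity_eq_delayProfile hK hM hlam hδ hN hy.1 hy.2.le,
      integral_const_mul, setIntegral_mul_delayProfile _ (by fun_prop),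
      Finset.sum_congr rfl fun q _ => setIntegral_indicator_delayTerm hM _ _ (by fun_prop) q
        (hasDerivAt_delayMass q) K]
    congr 1
    have hq : ∀ q ∈ Finset.range (N + 1),
        (if q * M < K then delayMass lam δ q K - delayMass lam δ q (q * M) else 0) =
          delayMass lam δ q K - if q = 0 then 1 else 0 := by
      intro q hq
      rw [← delayMass_left hδ q]
      split_ifs with hlt
      · rfl
      · have : (q : ℝ) ≤ N := by exact_mod_cast Nat.lt_succ_iff.1 (Finset.mem_range.1 hq)
        rw [le_antisymm (not_lt.1 hlt) ((mul_le_mul_of_nonneg_right this hM.le).trans hN'),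
          sub_self]
    rw [Finset.sum_congr rfl hq, Finset.sum_sub_distrib,
      Finset.sum_ite_eq' (Finset.range (N + 1)) 0]
    simp
  have h2 := h.integral_bufferDensity hK hM hlam
  rw [hmass] at h2
  linear_combination h2

end Solution

section Normalization

variable {M lam δ : ℝ}

lemma delayMass_eq (hM : 0 < M) (hδ : δ = lam * M) (q : ℕ) (y : ℝ) :
    delayMass lam δ q y =
      Real.exp (lam * y) * ((δ * Real.exp (-δ)) ^ q / (q.factorial : ℝ) * (q - y / M) ^ q) := by
  rw [delayMass, show lam * y - δ * q = -(δ * (q - y / M)) by rw [hδ]; field_simp; ring,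
    neg_pow, neg_pow (δ * _), mul_pow, mul_pow]
  have hsq : (-1 : ℝ) ^ q * (-1) ^ q = 1 := by rw [← mul_pow]; simp
  linear_combination (Real.exp (-δ) ^ q / (q.factorial : ℝ) *
    (δ ^ q * (q - y / M) ^ q * Real.exp (lam * y))) * hsq

lemma sum_delayMass_sub (hM : 0 < M) (hδ : δ = lam * M) (n : ℕ) (r : ℝ) :
    Real.exp (n * δ) * (Real.exp (lam * r) - 1 + ∑ q ∈ Finset.Icc 1 n,
        (δ * Real.exp (-δ)) ^ q / (Nat.factorial q : ℝ) *
          (Real.exp (lam * r) * ((q : ℝ) - (n * M + r) / M) ^ q - ((q : ℝ) - n) ^ q)) =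
      ∑ q ∈ Finset.range (n + 1), delayMass lam δ q (n * M + r) -
        ∑ q ∈ Finset.range (n + 1), delayMass lam δ q (n * M) := by
  rw [← Finset.sum_sub_distrib, Finset.sum_range_succ', add_comm (_ - _) (Finset.sum _ _), Finset.range_eq_Ico,
    Finset.sum_Ico_add' (fun q => delayMass lam δ q (n * M + r) - delayMass lam δ q (n * M)) 0 n 1,
    mul_add, Finset.mul_sum]
  have hexp : Real.exp (lam * (n * M)) = Real.exp (n * δ) := by rw [hδ]; ring_nf
  simp_rw [delayMass_eq hM hδ, mul_add lam, Real.exp_add, hexp]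
  congr 1
  · refine Finset.sum_congr (by ext; simp) fun q _ => ?_
    rw [mul_div_cancel_right₀ _ hM.ne']
    ring
  · simp
    ring

lemma sum_delayMass_succ (hδ : δ = lam * M) (n : ℕ) :
    ∑ q ∈ Finset.range (n + 1 + 1), delayMass lam δ q ((n + 1 : ℕ) * M) =
      ∑ q ∈ Finset.range (n + 1), delayMass lam δ q (n * M + M) := by
  rw [Finset.sum_range_succ, delayMass_left hδ, if_neg (Nat.succ_ne_zero n), add_zero]
  push_cast
  ring_nf

lemma sum_strips_eq (hM : 0 < M) (hδ : δ = lam * M) (l : ℕ) (Δ : ℝ) :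
    (∑ n ∈ Finset.range l, Real.exp (n * δ) *
            (Real.exp δ - 1 + ∑ q ∈ Finset.Icc 1 n,
              (δ * Real.exp (-δ)) ^ q / (Nat.factorial q : ℝ) *
                (Real.exp δ * ((q : ℝ) - (n + 1)) ^ q - ((q : ℝ) - n) ^ q))) +
          Real.exp (l * δ) *
            (Real.exp (lam * Δ) - 1 + ∑ q ∈ Finset.Icc 1 l,
              (δ * Real.exp (-δ)) ^ q / (Nat.factorial q : ℝ) *
                (Real.exp (lam * Δ) * ((q : ℝ) - (l * M + Δ) / M) ^ q - ((q : ℝ) - l) ^ q)) +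
          1 = ∑ q ∈ Finset.range (l + 1), delayMass lam δ q (l * M + Δ) := by
  have hstrip (n : ℕ) : Real.exp (n * δ) *
      (Real.exp δ - 1 + ∑ q ∈ Finset.Icc 1 n, (δ * Real.exp (-δ)) ^ q / (Nat.factorial q : ℝ) *
        (Real.exp δ * ((q : ℝ) - (n + 1)) ^ q - ((q : ℝ) - n) ^ q)) =
      ∑ q ∈ Finset.range (n + 1 + 1), delayMass lam δ q ((n + 1 : ℕ) * M) -
        ∑ q ∈ Finset.range (n + 1), delayMass lam δ q (n * M) := by
    have := sum_delayMass_sub hM hδ n M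
    rw [← hδ, show (n * M + M) / M = (n : ℝ) + 1 by field_simp] at this
    rw [this, sum_delayMass_succ hδ]
  simp_rw [hstrip]
  rw [Finset.sum_range_sub (fun n : ℕ => ∑ q ∈ Finset.range (n + 1), delayMass lam δ q (n * M)),
    sum_delayMass_sub hM hδ]
  simp [delayMass]

end Normalization

theorem corollary2 (K M lam δ Δ : ℝ) (l : ℕ) (hK : 0 < K) (hM : 0 < M) (hlam : 0 < lam)
    (hδ : δ = lam * M) (hΔ0 : 0 ≤ Δ) (hΔM : Δ < M) (hKl : K = l * M + Δ) :
    ∃ (π : Measure ℝ) (g : ℝ → ℝ),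
      -- `π` is the unique stationary distribution
      IsStationaryDistribution K M (expMeasure lam) π ∧
      (∀ π' : Measure ℝ, IsStationaryDistribution K M (expMeasure lam) π' → π' = π) ∧
      -- it is the limiting distribution of the storage process
      (∀ (Ω : Type u) [MeasurableSpace Ω] (P : Measure Ω) [IsProbabilityMeasure P]
          (X B : ℕ → Ω → ℝ), IsStorageProcess P K M (expMeasure lam) X B →
        Tendsto (fun i => tvDistance (P.map (B i)) π) atTop (𝓝 0)) ∧
      -- `g` is its density below the full level, the rest is the atom at `K`
      Measurable g ∧ (∀ x ∈ Ico 0 K, 0 ≤ g x) ∧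
      π = (volume.restrict (Ioo 0 K)).withDensity (fun x => ENNReal.ofReal (g x)) +
        π {K} • Measure.dirac K ∧
      -- the density on the strips
      (∀ n : ℕ, n ≤ (if Δ = 0 then l - 1 else l) →
        ∀ x : ℝ, max (K - (n + 1) * M) 0 ≤ x → x < K - n * M →
          g x = π.real {K} * lam * Real.exp (-lam * (x - K)) *
            (1 + ∑ q ∈ Finset.Icc 1 n,
              Real.exp (-δ * q) / (Nat.factorial (q - 1) : ℝ) *
                (δ * q + lam * (x - K)) ^ (q - 1) *
                (lam * (x - K) / q + δ - 1))) ∧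
      -- the full-buffer probability
      π.real {K} =
        ((∑ n ∈ Finset.range l, Real.exp (n * δ) *
            (Real.exp δ - 1 + ∑ q ∈ Finset.Icc 1 n,
              (δ * Real.exp (-δ)) ^ q / (Nat.factorial q : ℝ) *
                (Real.exp δ * ((q : ℝ) - (n + 1)) ^ q - ((q : ℝ) - n) ^ q))) +
          Real.exp (l * δ) *
            (Real.exp (lam * Δ) - 1 + ∑ q ∈ Finset.Icc 1 l,
              (δ * Real.exp (-δ)) ^ q / (Nat.factorial q : ℝ) *
                (Real.exp (lam * Δ) * ((q : ℝ) - K / M) ^ q - ((q : ℝ) - l) ^ q)) +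
          1)⁻¹ := by
  have := isProbabilityMeasure_expMeasure hlam
  have hIci : expMeasure lam (Ici K) ≠ 0 := by
    rw [expMeasure_Ici hlam hK.le]
    simp [Real.exp_pos]
  have hlt : (expMeasure lam).real (Iio K) < 1 := by
    rw [← compl_Ici, probReal_compl_eq_one_sub measurableSet_Ici]
    have : 0 < (expMeasure lam).real (Ici K) := ENNReal.toReal_pos hIci (measure_ne_top _ _)
    linarith
  obtain ⟨π, h⟩ := exists_isStationaryDistribution (M := M) hK.le expMeasure_Iio_zero hIci
  have hN : K ≤ (l + 1) * M := by linarith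
  have hN' : l * M ≤ K := by linarith
  refine ⟨π, bufferDensity M lam π, h, fun π' h' => h.eq hlt h', ?_,
    h.measurable_bufferDensity hK hM hlam, fun x _ => bufferDensity_nonneg hlam x,
    h.eq_withDensity_add_dirac hK hM hlam, ?_, ?_⟩
  · intro Ω _ P _ X B hB
    exact hB.tendsto_tvDistance hlt h
  · intro n hn x hx hx'
    have hnl : n < l + 1 := by
      split_ifs at hn <;> omega
    have h0 : 0 ≤ x := (le_max_right _ _).trans hx
    have h1 : K - (n + 1) * M ≤ x := (le_max_left _ _).trans hx
    have hxK : 0 < K - x := by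
      have : 0 ≤ n * M := by positivity
      linarith
    have h2 := h.bufferDensity_eq_delayProfile hK hM hlam hδ hN hxK (by linarith)
    rw [sub_sub_cancel, delayProfile_of_mem hM hnl (by linarith) (by linarith),
      sum_range_delayTerm] at h2
    rw [h2, ← mul_assoc, ← mul_assoc]
    simp_rw [show lam * (K - x) = -(lam * (x - K)) by ring, neg_neg, sub_neg_eq_add, neg_mul]
  · have h1 := h.real_singleton_mul_sum hK hM hlam hδ hN hN'
    rw [hKl, sum_strips_eq hM hδ, ← hKl]
    exact eq_inv_of_mul_eq_one_left h1
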